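/- Let $n\ge 0$ be an integer and let $T_n$ be the right Cayley tree, with respect to the free generators $a_1,\dots,a_n$, of either the free monoid $M_n$ or the free group $F_n$. Its vertices are identified with the words over $\{a_1,\dots,a_n\}$, respectively with the reduced words over $\{a_1^{\pm1},\dots,a_n^{\pm1}\}$. For vertices $v\neq e$ and $w$ let $\rho_v(w)$ be the number of (possibly overlapping) occurrences of $v$ as a contiguous (reduced) subword of $w$, and let $\rho_e(w)=|w|$ be the word length. Let $\mathcal C$ be the real vector space of functions spanned by all $\rho_v$, and $\widehat{\mathcal C}$ (that is, $\widehat{\mathcal C}(M_n)$ or $\widehat{\mathcal C}(F_n)$) its quotient by the bounded functions in $\mathcal C$. A weight $\alpha$ is a finitely supported real-valued function on the vertices; the weighted tree $(T_n,\alpha)$ represents the class of $c(T_n,\alpha)=\sum_w\alpha(w)\rho_w$ in $\widehat{\mathcal C}$, and its depth is $\max\{|w| : \alpha(w)\ne 0\}$ (and $-\infty$ if $\alpha=0$). The father of a vertex $w\ne e$ is the word obtained by deleting its last letter. The brotherhood of $w$ is the set of all vertices with the same father as $w$; its depth is $|w|$. Two non-empty words of equal length that differ at most in their first letter are called related, and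 the brotherhoods of related vertices are called related. Call a weighted tree $(T_n,\alpha)$ of depth $L\ge 2$ unbalanced if there are two related brotherhoods $B_1,B_2$ of depth $L$ such that $\alpha$ is identically zero on $B_1$ and $\alpha$ is not constant on the set of those members of $B_2$ that are related to some member of $B_1$. (This set is all of $B_2$ for $M_n$, and for $F_n$ when $L\ge 3$.) Theorem. Every unbalanced weighted tree represents a non-zero class in $\widehat{\mathcal C}(M_n)$, respectively $\widehat{\mathcal C}(F_n)$; that is, the function $c(T_n,\alpha)$ is unbounded. -/

import Mathlib

/-! Words, counting functions and weighted trees.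

Both cases are treated at once: `X` is the free monoid `M_n` or the free group `F_n`, and
`word : X → List A` sends an element to the (reduced) word that represents it. For `M_n` the
alphabet `A` is `Fin n`; for `F_n` it is `Fin n × Bool`, where `(i, true)` is the letter `a_i` and
`(i, false)` its inverse. -/

namespace CountingTree

/-- The word over `a_1, …, a_n` that is the given element of the free monoid `M_n`. -/
def monoidWord (n : ℕ) (w : FreeMonoid (Fin n)) : List (Fin n) := FreeMonoid.toList w

/-- The reduced word representing the given element of the free group `F_n`. -/
def groupWord (n : ℕ) (w : FreeGroup (Fin n)) : List (Fin n × Bool) := FreeGroup.toWord w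

section Counting

variable {X A : Type} [DecidableEq A]

/-- The counting function `ρ_v`: the number of positions `j` of the word of `w` at which the word
of `v` starts, overlaps allowed. For `v = e` every position counts, so that `ρ_e(w)` is the length
of `w`. -/
def rho (word : X → List A) (v w : X) : ℝ :=
  (((Finset.range (word w).length).filter (fun j => word v <+: (word w).drop j)).card : ℝ)

/-- The space `𝒞` of real functions spanned by the counting functions. -/
def countingSpace (word : X → List A) : Submodule ℝ (X → ℝ) :=
  Submodule.span ℝ (Set.range (rho word))

/-- The space of bounded real functions. -/
def boundedFunctions (X : Type) : Submodule ℝ (X → ℝ) where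
  carrier := {f | ∃ C : ℝ, ∀ x, |f x| ≤ C}
  zero_mem' := ⟨0, fun x => by simp⟩
  add_mem' := by
    rintro f g ⟨C, hC⟩ ⟨D, hD⟩
    exact ⟨C + D, fun x => (abs_add_le (f x) (g x)).trans (add_le_add (hC x) (hD x))⟩
  smul_mem' := by
    rintro c f ⟨C, hC⟩
    refine ⟨|c| * C, fun x => ?_⟩
    simpa [abs_mul] using mul_le_mul_of_nonneg_left (hC x) (abs_nonneg c)

/-- The quotient `𝒞̂` of `𝒞` by its bounded members. -/
abbrev CountingQuotient (word : X → List A) : Type :=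
  countingSpace word ⧸ (boundedFunctions X).submoduleOf (countingSpace word)

/-- The sum of counting functions `c(T_n, α) = ∑ α(w) ρ_w` of a weight `α`, as a member of `𝒞`. -/
noncomputable def countingSum (word : X → List A) (α : X →₀ ℝ) : countingSpace word :=
  α.sum fun w a => a • ⟨rho word w, Submodule.subset_span ⟨w, rfl⟩⟩

/-- The class in `𝒞̂` that the weighted tree `(T_n, α)` represents. -/
noncomputable def treeClass (word : X → List A) (α : X →₀ ℝ) : CountingQuotient word :=
  Submodule.Quotient.mk (countingSum word α)

end Counting

section Tree

variable {X A : Type}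

/-- The depth of a vertex of the right Cayley tree: its word length. -/
def depth (word : X → List A) (w : X) : ℕ := (word w).length

/-- `v` is the father of `w` in the right Cayley tree: the word of `w` is that of `v` followed by
one letter. -/
def IsFather (word : X → List A) (v w : X) : Prop := ∃ s : A, word w = word v ++ [s]

/-- The brotherhood of `w`: the vertices with the same father as `w`. -/
def brotherhood (word : X → List A) (w : X) : Set X :=
  {u | ∃ v, IsFather word v w ∧ IsFather word v u}

/-- `u ⌣ v`: the words of `u` and `v` are non-empty, have the same length, and differ at most in
their first letter. -/
def Related (word : X → List A) (u v : X) : Prop :=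
  ∃ (s t : A) (x : List A), word u = s :: x ∧ word v = t :: x

/-- `B` is a brotherhood of depth `L` (with `L ≥ 1`). -/
def IsBrotherhood (word : X → List A) (L : ℕ) (B : Set X) : Prop :=
  1 ≤ L ∧ ∃ w, depth word w = L ∧ B = brotherhood word w

/-- `B₁ ⌣ B₂`: the two sets are the brotherhoods of related vertices. -/
def RelatedBrotherhoods (word : X → List A) (B₁ B₂ : Set X) : Prop :=
  ∃ u v, Related word u v ∧ B₁ = brotherhood word u ∧ B₂ = brotherhood word v

/-- The members of `B₂` that are related to a member of `B₁`. -/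
def partners (word : X → List A) (B₁ B₂ : Set X) : Set X :=
  {v | v ∈ B₂ ∧ ∃ u ∈ B₁, Related word u v}

/-- The depth of the weighted tree `(T_n, α)`: the maximal depth of a vertex of non-zero weight,
and `⊥` if `α = 0`. -/
def treeDepth (word : X → List A) (α : X →₀ ℝ) : WithBot ℕ :=
  α.support.sup fun w => (depth word w : WithBot ℕ)

/-- `α` is constant on `B`. -/
def IsConstantOn (α : X →₀ ℝ) (B : Set X) : Prop := ∃ c : ℝ, ∀ w ∈ B, α w = c

/-- The weighted tree `(T_n, α)` is unbalanced: it has some depth `L ≥ 2`, and there are related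
brotherhoods `B₁ ⌣ B₂` of depth `L` such that `α` is zero on `B₁` and not constant on `B₂`, where
only those members of `B₂` are compared that correspond to a member of `B₁`.

That last clause is void, `partners word B₁ B₂` being all of `B₂`, in the free monoid and, for
`L ≥ 3`, in the free group (`partners_monoid`, `partners_group`). In the free group at `L = 2` the
brotherhoods of fathers `x ≠ y` (letters) are not in bijection: `y x⁻¹` has no related vertex in
the brotherhood with father `x`. -/
def Unbalanced (word : X → List A) (α : X →₀ ℝ) : Prop :=
  ∃ L : ℕ, 2 ≤ L ∧ treeDepth word α = (L : WithBot ℕ) ∧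
    ∃ B₁ B₂ : Set X, IsBrotherhood word L B₁ ∧ IsBrotherhood word L B₂ ∧
      RelatedBrotherhoods word B₁ B₂ ∧
      (∀ w ∈ B₁, α w = 0) ∧ ¬ IsConstantOn α (partners word B₁ B₂)

end Tree

/-- If `s q d` and `t q c` are vertices, and the words `s q` and `s q c` are vertices too, then the
member `t q c` of the brotherhood of `t q d` corresponds to a member of that of `s q d`. -/
theorem partners_eq {X A : Type} (word : X → List A) (L : ℕ) (hL : 2 ≤ L)
    (key : ∀ (s t c d : A) (q : List A), q.length + 2 = L → (∃ u, word u = s :: q ++ [d]) →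
      (∃ w, word w = t :: q ++ [c]) →
      (∃ f, word f = s :: q) ∧ ∃ u, word u = s :: q ++ [c])
    (B₁ B₂ : Set X) (h₂ : IsBrotherhood word L B₂) (h : RelatedBrotherhoods word B₁ B₂) :
    partners word B₁ B₂ = B₂ := by
  obtain ⟨u, v, ⟨s, t, x, hu, hv⟩, rfl, rfl⟩ := h
  obtain ⟨-, w', hw', hB⟩ := h₂
  refine Set.Subset.antisymm (fun w hw => hw.1) (fun w hw => ⟨hw, ?_⟩)
  have hlen : (word w).length = L := by
    obtain ⟨p, ⟨a, ha⟩, ⟨b, hb⟩⟩ := (hB ▸ hw : w ∈ brotherhood word w')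
    rw [← hw', depth, ha, hb]; simp
  obtain ⟨p, ⟨d, hd⟩, ⟨c, hc⟩⟩ := hw
  rw [hv] at hd
  cases hp : word p with
  | nil => rw [hc, hp] at hlen; simp at hlen; omega
  | cons t' q =>
    rw [hp] at hd hc
    obtain ⟨rfl, rfl⟩ : t = t' ∧ x = q ++ [d] := by simpa using hd
    rw [hc] at hlen
    obtain ⟨⟨f, hf⟩, u', hu'⟩ := key s t c d q (by simpa using hlen) ⟨u, by simpa using hu⟩ ⟨w, hc⟩
    exact ⟨u', ⟨f, ⟨d, by rw [hu, hf]; simp⟩, ⟨c, by rw [hu', hf]⟩⟩,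
      s, t, q ++ [c], by simpa using hu', by simpa using hc⟩

/-- In the free monoid, every member of a brotherhood of depth at least `2` corresponds to a member
of each related brotherhood. -/
theorem partners_monoid (n L : ℕ) (hL : 2 ≤ L) (B₁ B₂ : Set (FreeMonoid (Fin n)))
    (h₂ : IsBrotherhood (monoidWord n) L B₂)
    (h : RelatedBrotherhoods (monoidWord n) B₁ B₂) :
    partners (monoidWord n) B₁ B₂ = B₂ :=
  partners_eq _ L hL (fun s _ c _ q _ _ _ =>
    ⟨⟨FreeMonoid.ofList (s :: q), rfl⟩, ⟨FreeMonoid.ofList (s :: q ++ [c]), rfl⟩⟩) B₁ B₂ h₂ h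

/-- In the free group, every member of a brotherhood of depth at least `3` corresponds to a member
of each related brotherhood. -/
theorem partners_group (n L : ℕ) (hL : 3 ≤ L) (B₁ B₂ : Set (FreeGroup (Fin n)))
    (h₂ : IsBrotherhood (groupWord n) L B₂)
    (h : RelatedBrotherhoods (groupWord n) B₁ B₂) :
    partners (groupWord n) B₁ B₂ = B₂ := by
  refine partners_eq _ L (by omega) (fun s t c d q hq hu hw => ?_) B₁ B₂ h₂ h
  obtain ⟨u, hu⟩ := hu
  obtain ⟨w, hw⟩ := hw
  have hru : FreeGroup.IsReduced (s :: q ++ [d]) := hu ▸ FreeGroup.isReduced_toWord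
  have hrw : FreeGroup.IsReduced (t :: q ++ [c]) := hw ▸ FreeGroup.isReduced_toWord
  have h1 : FreeGroup.IsReduced (s :: q) := hru.infix ⟨[], [d], by simp⟩
  have h2 : FreeGroup.IsReduced (q ++ [c]) := hrw.infix ⟨[t], [], by simp⟩
  have hne : q ≠ [] := by rintro rfl; simp at hq; omega
  have h3 : FreeGroup.IsReduced (s :: q ++ [c]) := by
    simpa using FreeGroup.IsReduced.append_overlap (L₁ := [s]) (by simpa using h1) h2 hne
  exact ⟨⟨FreeGroup.mk (s :: q), by rw [groupWord, FreeGroup.toWord_mk, h1.reduce_eq]⟩,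
    ⟨FreeGroup.mk (s :: q ++ [c]), by rw [groupWord, FreeGroup.toWord_mk, h3.reduce_eq]⟩⟩

end CountingTree

namespace CountingTree

/-! ### Local computation of sums of counting functions. -/

section Lists

variable {X A : Type} [DecidableEq A]

/-! Let L be the depth. Unbalance gives letters s, t, c ≠ c' and a word q of length L - 2 such that
`α` vanishes at sqc and sqc' but differs at tqc and tqc'. With connecting letters z, z', compare
powers of the three periodic words (tqcz)(sqc'z'), tqc'z' and sqcz. Only windows of length at most L
matter, and the long period shows the same windows as the two short ones together, except those of
full length starting at t or s. Subtracting the two short sums from the long one, each further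
period therefore adds α(tqc) - α(tqc') + α(sqc') - α(sqc), whose last two terms cancel
(`weightBefore_powers`). This linear growth is impossible if all three sums are bounded.

In the free group, z and z' must keep the powers reduced; `exists_letter_between` supplies them. -/

omit [DecidableEq A] in
theorem prefix_append_iff {u l r : List A} (h : u.length ≤ l.length) :
    u <+: l ++ r ↔ u <+: l :=
  ⟨fun hu => List.prefix_of_prefix_length_le hu (List.prefix_append l r) h,
    List.prefix_append_of_prefix⟩

/-- The total weight of the words that start at the beginning of the list `l`. -/
noncomputable def prefixWeight (word : X → List A) (α : X →₀ ℝ) (l : List A) : ℝ :=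
  α.sum fun w a => if word w <+: l then a else 0

/-- The total weight of the occurrences in `l ++ r` of words that start inside `l`. -/
noncomputable def weightBefore (word : X → List A) (α : X →₀ ℝ) : List A → List A → ℝ
  | [], _ => 0
  | a :: l, r => prefixWeight word α (a :: l ++ r) + weightBefore word α l r

theorem weightBefore_append (word : X → List A) (α : X →₀ ℝ) (l m r : List A) :
    weightBefore word α (l ++ m) r =
      weightBefore word α l (m ++ r) + weightBefore word α m r := by
  induction l with
  | nil => simp [weightBefore]
  | cons a l ih =>
    simp only [List.cons_append, weightBefore, ih, List.append_assoc]
    ring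

theorem prefixWeight_append_congr {word : X → List A} {α : X →₀ ℝ} {L : ℕ}
    (hα : ∀ w ∈ α.support, (word w).length ≤ L) {l : List A} (hl : L ≤ l.length)
    (r r' : List A) :
    prefixWeight word α (l ++ r) = prefixWeight word α (l ++ r') := by
  refine Finset.sum_congr rfl fun w hw => ?_
  have h := (hα w hw).trans hl
  simp only [prefix_append_iff h]

/-- A weighted word starting at the last letter of `l` reaches at most L - 1 letters further, so it
ends inside `p`. -/
theorem weightBefore_append_congr {word : X → List A} {α : X →₀ ℝ} {L : ℕ}
    (hα : ∀ w ∈ α.support, (word w).length ≤ L) (l : List A) {p : List A}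
    (hp : L ≤ p.length + 1) (r r' : List A) :
    weightBefore word α l (p ++ r) = weightBefore word α l (p ++ r') := by
  induction l with
  | nil => rfl
  | cons a l ih =>
    have h := prefixWeight_append_congr hα (l := a :: l ++ p) (by simp; omega) r r'
    simp only [List.append_assoc] at h
    simp only [weightBefore, ih, h]

/-- Prefixes of length at most `m.length` are common to both lists, and longer ones carry weight
only at length `m.length + 1`. -/
theorem prefixWeight_sub {word : X → List A} (hinj : Function.Injective word) {α : X →₀ ℝ}
    {m : List A} (hα : ∀ w ∈ α.support, (word w).length ≤ m.length + 1) {c c' : A} {v v' : X}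
    (hv : word v = m ++ [c]) (hv' : word v' = m ++ [c']) (r r' : List A) :
    prefixWeight word α (m ++ c :: r) - prefixWeight word α (m ++ c' :: r') = α v - α v' := by
  classical
  have key : ∀ (d : A) (u : X) (t : List A), word u = m ++ [d] →
      prefixWeight word α (m ++ d :: t) = prefixWeight word α m + α u := by
    intro d u t hu
    have h1 : α u = α.sum fun w a => if w = u then a else 0 := by simp
    rw [h1, prefixWeight, prefixWeight, Finsupp.sum, Finsupp.sum, Finsupp.sum,
      ← Finset.sum_add_distrib]
    refine Finset.sum_congr rfl fun w hw => ?_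
    have hwl := hα w hw
    have hmd : m ++ d :: t = (m ++ [d]) ++ t := by simp
    have h2 : word w <+: m ++ d :: t ↔ word w <+: m ++ [d] := by
      rw [hmd]
      exact prefix_append_iff (by simpa using hwl)
    have h3 : word w = m ++ [d] ↔ w = u := by rw [← hu]; exact hinj.eq_iff
    have h4 : word w <+: m ++ [d] ↔ word w = m ++ [d] ∨ word w <+: m := by
      rw [← List.prefix_concat_iff]
    simp only [h2, h4, h3]
    by_cases hwu : w = u
    · have h5 : ¬ word w <+: m := fun h => by
        have := h.length_le
        rw [h3.2 hwu] at this
        simp at this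
      simp [hwu, hwu ▸ h5]
    · simp [hwu]
  rw [key c v r hv, key c' v' r' hv']
  ring

theorem countingSum_apply (word : X → List A) (α : X →₀ ℝ) (g : X) :
    (countingSum word α : X → ℝ) g = weightBefore word α (word g) [] := by
  have key : ∀ l : List A, weightBefore word α l [] =
      ∑ j ∈ Finset.range l.length, prefixWeight word α (l.drop j) := by
    intro l
    induction l with
    | nil => simp [weightBefore]
    | cons a l ih => simp [weightBefore, Finset.sum_range_succ', ih, add_comm]
  have hsum : (countingSum word α : X → ℝ) g = α.sum fun w a => a * rho word w g := by
    simp [countingSum, Finsupp.sum]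
  rw [hsum, key]
  simp only [prefixWeight, Finsupp.sum]
  rw [Finset.sum_comm]
  refine Finset.sum_congr rfl fun w _ => ?_
  rw [rho, ← Finset.sum_filter, Finset.sum_const, nsmul_eq_mul, mul_comm]

end Lists

/-! ### Periodic words and unbounded growth. -/

section Chains

variable {X A : Type}

/-- The closing letter `a` in `h` is the first letter of the next copy, so `h` also covers the
junctions. -/
theorem isChain_flatten_replicate {R : A → A → Prop} {a : A} {m : List A}
    (h : (a :: m ++ [a]).IsChain R) (k : ℕ) :
    (List.replicate k (a :: m)).flatten.IsChain R := by
  induction k with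
  | zero => simp
  | succ k ih =>
    cases k with
    | zero => simpa using h.prefix (List.prefix_append _ _)
    | succ k =>
      have := h.append_overlap (l₃ := m ++ (List.replicate k (a :: m)).flatten)
        (by simpa [List.replicate_succ] using ih) (by simp)
      simpa [List.replicate_succ] using this

theorem isChain_link {R : A → A → Prop} {l m : List A} {c z b : A}
    (hl : (l ++ [c]).IsChain R) (hc : R c z) (hb : R z b) (hm : (b :: m).IsChain R) :
    (l ++ c :: z :: b :: m).IsChain R := by
  rw [List.isChain_append_cons_cons, List.isChain_cons_cons]
  exact ⟨hl, hc, hb, hm⟩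

variable [DecidableEq A]

/-- Comparing the powers of `t q c z s q c' z'` with those of `t q c' z'` and of `s q c z` isolates
the difference of the weights at `t q c` and `t q c'`. -/
theorem weightBefore_powers {word : X → List A} (hinj : Function.Injective word) {α : X →₀ ℝ}
    {q : List A} {s t c c' : A} (hα : ∀ w ∈ α.support, (word w).length ≤ q.length + 2)
    {u u' v v' : X} (hu : word u = s :: q ++ [c]) (hu' : word u' = s :: q ++ [c'])
    (hv : word v = t :: q ++ [c]) (hv' : word v' = t :: q ++ [c'])
    (hαu : α u = α u') (z z' : A) (k : ℕ) :
    let D : ℕ → ℝ := fun k =>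
      weightBefore word α
          (List.replicate k (t :: (q ++ c :: z :: s :: (q ++ [c', z'])))).flatten [] -
        weightBefore word α (List.replicate k (t :: (q ++ [c', z']))).flatten [] -
        weightBefore word α (List.replicate k (s :: (q ++ [c, z]))).flatten []
    D (k + 1) = D 1 + k * (α v - α v') := by
  intro D
  induction k with
  | zero => simp
  | succ k ih =>
    have step : D (k + 1 + 1) = D (k + 1) + (α v - α v') := by
      -- At least one period must follow the one split off, so that its last windows see `t :: q` or
      -- `s :: q`; hence the recursion starts at `D 1`.
      obtain ⟨W, hW⟩ : ∃ W, (List.replicate (k + 1)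
          (t :: (q ++ c :: z :: s :: (q ++ [c', z'])))).flatten = t :: q ++ W := by
        simp [List.replicate_succ]
      obtain ⟨T, hT⟩ : ∃ T, (List.replicate (k + 1) (t :: (q ++ [c', z']))).flatten =
          t :: q ++ T := by
        simp [List.replicate_succ]
      obtain ⟨S, hS⟩ : ∃ S, (List.replicate (k + 1) (s :: (q ++ [c, z]))).flatten =
          s :: q ++ S := by
        simp [List.replicate_succ]
      simp only [D]
      rw [List.replicate_succ (n := k + 1), List.replicate_succ (n := k + 1),
        List.replicate_succ (n := k + 1), List.flatten_cons, List.flatten_cons,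
        List.flatten_cons, hW, hT, hS]
      have e : t :: (q ++ c :: z :: s :: (q ++ [c', z'])) =
        (t :: (q ++ [c, z])) ++ (s :: (q ++ [c', z'])) := by simp
      rw [e]
      simp only [weightBefore_append word α _ _ []]
      rw [weightBefore_append word α _ (s :: (q ++ [c', z']))]
      -- Windows starting at neither t nor s cancel (`h1`, `h2`); those starting at t and s give the
      -- two weight differences (`h3`, `h4`).
      have h1 := weightBefore_append_congr hα (q ++ [c, z]) (p := s :: q) (by simp)
        ([c', z'] ++ (t :: q ++ W)) S
      have h2 := weightBefore_append_congr hα (q ++ [c', z']) (p := t :: q) (by simp) W T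
      have h3 := prefixWeight_sub hinj (m := t :: q) hα hv hv'
        (z :: (s :: q ++ ([c', z'] ++ (t :: q ++ W)))) (z' :: (t :: q ++ T))
      have h4 := prefixWeight_sub hinj (m := s :: q) hα hu hu'
        (z :: (s :: q ++ S)) (z' :: (t :: q ++ W))
      simp only [weightBefore, List.append_assoc, List.cons_append, List.nil_append,
        List.append_nil] at h1 h2 h3 h4 ⊢
      linarith
    rw [step, ih]
    push_cast
    ring

/-- Unbalanced weights on a tree whose vertices are the words without forbidden pairs of
consecutive letters have unbounded sums of counting functions, provided that a branching of the tree
allows one to connect any two letters through a third one. -/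
theorem Unbalanced.not_bounded {R : A → A → Prop} {word : X → List A}
    (hinj : Function.Injective word) (hchain : ∀ g, (word g).IsChain R)
    (hsurj : ∀ l : List A, l.IsChain R → ∃ g, word g = l)
    (hlink : ∀ e c c', c ≠ c' → R e c → R e c' → ∀ a b, ∃ z, R a z ∧ R z b)
    {α : X →₀ ℝ} (h : Unbalanced word α) :
    ¬ ∃ C : ℝ, ∀ g, |(countingSum word α : X → ℝ) g| ≤ C := by
  obtain ⟨L, hL, hdepth, B₁, B₂, ⟨-, w₁, hw₁, hB₁⟩, -, ⟨u₀, v₀, ⟨s, t, x, hu₀, hv₀⟩, h₁, h₂⟩,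
    hzero, hconst⟩ := h
  have hα : ∀ w ∈ α.support, (word w).length ≤ L := fun w hw => by
    have := Finset.le_sup (f := fun w => (depth word w : WithBot ℕ)) hw
    rw [show α.support.sup (fun w => (depth word w : WithBot ℕ)) = L from hdepth] at this
    exact_mod_cast this
  have hlen : ∀ y w, y ∈ brotherhood word w → (word y).length = (word w).length := by
    rintro y w ⟨p, ⟨a, ha⟩, ⟨b, hb⟩⟩
    simp [ha, hb]
  obtain ⟨v, v', hv, hv', hne⟩ : ∃ v v', v ∈ partners word B₁ B₂ ∧ v' ∈ partners word B₁ B₂ ∧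
      α v ≠ α v' := by
    by_contra! hcon
    rcases (partners word B₁ B₂).eq_empty_or_nonempty with h0 | ⟨y, hy⟩
    · exact hconst ⟨0, by simp [h0]⟩
    · exact hconst ⟨α y, fun w hw => hcon w y hw hy⟩
  obtain ⟨y, hy, -⟩ := hv.2
  have hxL : x.length + 1 = L := by
    have e1 := hlen y w₁ (hB₁ ▸ hy)
    have e2 := hlen y u₀ (h₁ ▸ hy)
    rw [hu₀] at e2
    rw [← hw₁, depth, ← e1, e2, List.length_cons]
  obtain ⟨q, d, rfl⟩ : ∃ q d, x = q ++ [d] := by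
    rcases List.eq_nil_or_concat x with rfl | ⟨q, d, rfl⟩
    · simp at hxL
      omega
    · exact ⟨q, d, by simp⟩
  have member : ∀ (y y₀ : X) (r : A), word y₀ = r :: (q ++ [d]) → y ∈ brotherhood word y₀ →
      ∃ c, word y = r :: q ++ [c] := by
    rintro y y₀ r hy₀ ⟨p, ⟨a, ha⟩, ⟨b, hb⟩⟩
    rw [hy₀, ← List.cons_append] at ha
    exact ⟨b, by rw [hb, (List.append_inj' ha rfl).1]⟩
  have pair : ∀ v ∈ partners word B₁ B₂, ∃ c u, word v = t :: q ++ [c] ∧ word u = s :: q ++ [c] ∧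
      α u = 0 := by
    rintro v ⟨hvB, u, huB, s', t', x', hu, hv⟩
    obtain ⟨c, hc⟩ := member v v₀ t hv₀ (h₂ ▸ hvB)
    obtain ⟨b, hb⟩ := member u u₀ s hu₀ (h₁ ▸ huB)
    have hcb : c = b := by
      have e1 := hv.symm.trans hc
      have e2 := hu.symm.trans hb
      simp only [List.cons_append, List.cons.injEq] at e1 e2
      simpa using e1.2.symm.trans e2.2
    subst hcb
    exact ⟨c, u, hc, hb, hzero u huB⟩
  obtain ⟨c, u, hvc, huc, hu⟩ := pair v hv
  obtain ⟨c', u', hvc', huc', hu'⟩ := pair v' hv'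
  have hcc : c ≠ c' := by
    rintro rfl
    exact hne (congrArg α (hinj (hvc.trans hvc'.symm)))
  -- The vertex tq has two distinct sons, so its last letter `e` provides the branching that `hlink`
  -- requires.
  obtain ⟨m, e, hme⟩ : ∃ m e, t :: q = m ++ [e] :=
    ⟨_, _, (List.dropLast_append_getLast (List.cons_ne_nil t q)).symm⟩
  have hR : ∀ v c, word v = t :: q ++ [c] → R e c := fun v c hvc => by
    have := hchain v
    rw [hvc, hme, List.append_assoc] at this
    simpa using this.right_of_append
  have link := hlink e c c' hcc (hR v c hvc) (hR v' c' hvc')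
  obtain ⟨z, hcz, hzs⟩ := link c s
  obtain ⟨z', hcz', hzt⟩ := link c' t
  have ch : ∀ y l, word y = l → l.IsChain R := fun y l h => h ▸ hchain y
  have chain_y : (s :: (q ++ [c', z']) ++ [t]).IsChain R := by
    simpa using isChain_link (ch _ _ huc') hcz' hzt (List.isChain_singleton t)
  have chain_x' : (t :: (q ++ [c', z']) ++ [t]).IsChain R := by
    simpa using isChain_link (ch _ _ hvc') hcz' hzt (List.isChain_singleton t)
  have chain_y' : (s :: (q ++ [c, z]) ++ [s]).IsChain R := by
    simpa using isChain_link (ch _ _ huc) hcz hzs (List.isChain_singleton s)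
  have chain_xy : (t :: (q ++ c :: z :: s :: (q ++ [c', z'])) ++ [t]).IsChain R := by
    simpa using isChain_link (ch _ _ hvc) hcz hzs chain_y
  rintro ⟨C, hC⟩
  have bound : ∀ l : List A, l.IsChain R → |weightBefore word α l []| ≤ C := fun l hl => by
    obtain ⟨g, rfl⟩ := hsurj l hl
    rw [← countingSum_apply]
    exact hC g
  have hα' : ∀ w ∈ α.support, (word w).length ≤ q.length + 2 := fun w hw => by
    have := hα w hw
    simp at hxL
    omega
  -- The growth term is a difference of two values of `D`, each combining three sums bounded by `C`.
  obtain ⟨k, hk⟩ := exists_nat_gt (6 * C / |α v - α v'|)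
  rw [div_lt_iff₀ (abs_pos.2 (sub_ne_zero.2 hne))] at hk
  have main := weightBefore_powers hinj hα' huc huc' hvc hvc' (hu.trans hu'.symm) z z' k
  have b : ∀ j, _ := fun j => abs_le.1 (bound _ (isChain_flatten_replicate chain_xy j))
  have b' : ∀ j, _ := fun j => abs_le.1 (bound _ (isChain_flatten_replicate chain_x' j))
  have b'' : ∀ j, _ := fun j => abs_le.1 (bound _ (isChain_flatten_replicate chain_y' j))
  rw [← Nat.abs_cast k, ← abs_mul] at hk
  have := (abs_le (a := (k : ℝ) * (α v - α v')) (b := 6 * C)).2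
    ⟨by linarith [b 1, b' 1, b'' 1, b (k + 1), b' (k + 1), b'' (k + 1)],
      by linarith [b 1, b' 1, b'' 1, b (k + 1), b' (k + 1), b'' (k + 1)]⟩
  linarith

theorem treeClass_ne_zero {word : X → List A} {α : X →₀ ℝ}
    (h : ¬ ∃ C : ℝ, ∀ g, |(countingSum word α : X → ℝ) g| ≤ C) : treeClass word α ≠ 0 :=
  fun h0 => h ((Submodule.Quotient.mk_eq_zero _).1 h0)

end Chains

/-! ### Connecting letters in the free group. -/

/-- Only the inverses of `a` and `b` are forbidden for `z`, while the inverse of `e`, `c` and `c'`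
are three distinct letters. The branching at `e` thus replaces an assumption on the rank. -/
theorem exists_letter_between {n : ℕ} (e c c' : Fin n × Bool) (hcc : c ≠ c')
    (hc : e.1 = c.1 → e.2 = c.2) (hc' : e.1 = c'.1 → e.2 = c'.2) (a b : Fin n × Bool) :
    ∃ z : Fin n × Bool, (a.1 = z.1 → a.2 = z.2) ∧ (z.1 = b.1 → z.2 = b.2) := by
  have h : ({(a.1, !a.2), (b.1, !b.2)} : Finset (Fin n × Bool)).card <
      ({(e.1, !e.2), c, c'} : Finset (Fin n × Bool)).card := by
    have h3 : ({(e.1, !e.2), c, c'} : Finset (Fin n × Bool)).card = 3 := by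
      refine Finset.card_eq_three.2 ⟨_, _, _, ?_, ?_, hcc, rfl⟩
      · rintro rfl
        simp at hc
      · rintro rfl
        simp at hc'
    rw [h3]
    exact Nat.lt_succ_of_le Finset.card_le_two
  obtain ⟨z, -, hz⟩ := Finset.exists_mem_notMem_of_card_lt_card h
  obtain ⟨i, x⟩ := z
  obtain ⟨j, y⟩ := a
  obtain ⟨l, w⟩ := b
  refine ⟨(i, x), ?_⟩
  simp only [Finset.mem_insert, Finset.mem_singleton, Prod.mk.injEq, not_or, not_and] at hz
  refine ⟨?_, ?_⟩
  · rintro rfl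
    have := hz.1 rfl
    revert this
    cases x <;> cases y <;> simp
  · rintro rfl
    have := hz.2 rfl
    revert this
    cases x <;> cases w <;> simp

end CountingTree

open CountingTree in
theorem theorem4p2 (n : ℕ) :
    (∀ α : FreeMonoid (Fin n) →₀ ℝ, Unbalanced (monoidWord n) α →
      treeClass (monoidWord n) α ≠ 0 ∧
        ¬ ∃ C : ℝ, ∀ g : FreeMonoid (Fin n),
          |(countingSum (monoidWord n) α : FreeMonoid (Fin n) → ℝ) g| ≤ C) ∧
    (∀ α : FreeGroup (Fin n) →₀ ℝ, Unbalanced (groupWord n) α →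
      treeClass (groupWord n) α ≠ 0 ∧
        ¬ ∃ C : ℝ, ∀ g : FreeGroup (Fin n),
          |(countingSum (groupWord n) α : FreeGroup (Fin n) → ℝ) g| ≤ C) := by
  refine ⟨fun α hα => ?_, fun α hα => ?_⟩
  · have h := hα.not_bounded (R := fun _ _ => True) FreeMonoid.toList.injective
      (fun g => (List.pairwise_of_forall fun _ _ => trivial).isChain) (fun l _ => ⟨FreeMonoid.ofList l, rfl⟩)
      (fun _ _ _ _ _ _ a _ => ⟨a, trivial, trivial⟩)
    exact ⟨treeClass_ne_zero h, h⟩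
  · have h := hα.not_bounded (R := fun a b : Fin n × Bool => a.1 = b.1 → a.2 = b.2) FreeGroup.toWord_injective
      (fun g => FreeGroup.isReduced_toWord)
      (fun l hl => ⟨FreeGroup.mk l, by
        rw [FreeGroup.toWord_mk, FreeGroup.IsReduced.reduce_eq hl]⟩)
      exists_letter_between
    exact ⟨treeClass_ne_zero h, h⟩
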